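/- For an $m\times m$ complex matrix $M$ with no zero entry let $M^{(-)}$ be its Schur (entrywise) inverse, $(M^{(-)})_{ij}=1/M_{ij}$, and let $\circ$ be the entrywise product. The Nomura algebra $\mathcal N_M$ is the set of all $m\times m$ complex matrices for which every vector $Me_i\circ M^{(-)}e_j$ $(1\le i,j\le m)$ is an eigenvector. For $n\times n$ complex matrices $A,B$ let $X_A(M)=AM$ and $\Delta_B(M)=B\circ M$, as linear maps on the space of $n\times n$ matrices. The pair $(A,B)$ is a one-sided Jones pair if $X_A$ and $\Delta_B$ are invertible and $X_A\Delta_BX_A=\Delta_BX_A\Delta_B$; it is an invertible Jones pair if $(A,B)$ and $(A,B^T)$ are both one-sided Jones pairs, $A$ has no zero entry and $B$ is invertible. Let $\pi=(C_1,\dots,C_r)$ be a partition of $\{1,\dots,m\}$, with $m\times r$ characteristic matrix $S$ ($S_{ik}=1$ if $i\in C_k$, and $S_{ik}=0$ otherwise), and let $\mathcal B$ be a set of $m\times m$ matrices. The partition $\pi$ is equitable relative to $\mathcal B$ if for every $M\in\mathcal B$ there is an $r\times r$ matrix $B_M$ with $MS=SB_M$; then $\{B_M: M\in\mathcal B\}$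 is called the quotient of $\mathcal B$ with respect to $\pi$. **Theorem.** Let $(A,B)$ be an invertible Jones pair of $n\times n$ complex matrices with $A$ symmetric, let $d\in\mathbb C$ with $d^2=n$, write $B^{(-)T}=(B^{(-)})^T$, and put $$W=\begin{pmatrix}A^T&-A^T\\ B^{(-)T}&B^{(-)T}\end{pmatrix},\qquad V=\begin{pmatrix}dA&-dA&B^{(-)}&B^{(-)}\\-dA&dA&B^{(-)}&B^{(-)}\\ B^{(-)T}&B^{(-)T}&dA&-dA\\ B^{(-)T}&B^{(-)T}&-dA&dA\end{pmatrix}.$$ For $i=1,\dots,n,2n+1,\dots,3n$ let $C_i=\{i,n+i\}$, and let $\pi=(C_1,\dots,C_n,C_{2n+1},\dots,C_{3n})$, a partition of $\{1,\dots,4n\}$. Then $\pi$ is equitable relative to $\mathcal N_V$, and the quotient of $\mathcal N_V$ with respect to $\pi$ is $\mathcal N_W$. -/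

import Mathlib

open scoped Matrix

noncomputable section

namespace JonesPair

variable {ι κ : Type*}

/-- The Schur inverse `A⁽⁻⁾`, the entrywise inverse of `A`. -/
def schurInv (A : Matrix ι ι ℂ) : Matrix ι ι ℂ := A.map (·⁻¹)

/-- All entries are nonzero, i.e. `A` is invertible for the Schur product. -/
def SchurInvertible (A : Matrix ι ι ℂ) : Prop := ∀ i j, A i j ≠ 0

/-- The endomorphism `X_A : M ↦ A M`. -/
def opX [Fintype ι] (A : Matrix ι ι ℂ) : Module.End ℂ (Matrix ι ι ℂ) where
  toFun M := A * M
  map_add' M N := Matrix.mul_add A M N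
  map_smul' c M := Matrix.mul_smul A c M

/-- The endomorphism `Δ_A : M ↦ A ∘ M` (Schur product). -/
def opΔ (A : Matrix ι ι ℂ) : Module.End ℂ (Matrix ι ι ℂ) where
  toFun M := A ⊙ M
  map_add' M N := Matrix.hadamard_add A M N
  map_smul' c M := Matrix.hadamard_smul A M c

/-- `(A, B)` is a one-sided Jones pair: `X_A` and `Δ_B` are invertible and
`X_A Δ_B X_A = Δ_B X_A Δ_B`. -/
structure IsOneSidedJonesPair [Fintype ι] (A B : Matrix ι ι ℂ) : Prop where
  isUnit_opX : IsUnit (opX A)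
  isUnit_opΔ : IsUnit (opΔ B)
  braid : opX A * opΔ B * opX A = opΔ B * opX A * opΔ B

/-- `(A, B)` is an invertible Jones pair: `(A, B)` and `(A, Bᵀ)` are one-sided Jones pairs,
`A` is Schur invertible and `B` is invertible. -/
structure IsInvertibleJonesPair [Fintype ι] [DecidableEq ι] (A B : Matrix ι ι ℂ) : Prop where
  left : IsOneSidedJonesPair A B
  right : IsOneSidedJonesPair A Bᵀ
  schurInvertible : SchurInvertible A
  isUnit : IsUnit B

/-- The vector `A e_i ∘ A⁽⁻⁾ e_j`. -/
def nomuraVec (A : Matrix ι ι ℂ) (i j : ι) : ι → ℂ := fun k => A k i * schurInv A k j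

/-- The Nomura algebra `N_A`: the matrices for which every `A e_i ∘ A⁽⁻⁾ e_j` is
an eigenvector. -/
def nomura [Fintype ι] [DecidableEq ι] (A : Matrix ι ι ℂ) : Subalgebra ℂ (Matrix ι ι ℂ) where
  carrier := {M | ∀ i j, ∃ c : ℂ, M *ᵥ nomuraVec A i j = c • nomuraVec A i j}
  mul_mem' := by
    intro M N hM hN i j
    obtain ⟨a, ha⟩ := hM i j
    obtain ⟨b, hb⟩ := hN i j
    exact ⟨b * a, by rw [← Matrix.mulVec_mulVec, hb, Matrix.mulVec_smul, ha, smul_smul]⟩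
  add_mem' := by
    intro M N hM hN i j
    obtain ⟨a, ha⟩ := hM i j
    obtain ⟨b, hb⟩ := hN i j
    exact ⟨a + b, by rw [Matrix.add_mulVec, ha, hb, add_smul]⟩
  algebraMap_mem' := by
    intro r i j
    exact ⟨r, by rw [Algebra.algebraMap_eq_smul_one, Matrix.smul_mulVec, Matrix.one_mulVec]⟩

open Classical in
/-- The characteristic matrix of a family of cells: the `(i, k)` entry is `1` if `i ∈ C k`
and `0` otherwise. -/
def charMatrix (C : κ → Set ι) : Matrix ι κ ℂ := Matrix.of fun i k => if i ∈ C k then 1 else 0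

/-- The partition with cells `C` is equitable relative to the set `𝓑` of matrices: every
`M ∈ 𝓑` has some `Q` with `M S = S Q`, for `S` the characteristic matrix. -/
def IsEquitable [Fintype ι] [Fintype κ] (𝓑 : Set (Matrix ι ι ℂ)) (C : κ → Set ι) : Prop :=
  ∀ M ∈ 𝓑, ∃ Q : Matrix κ κ ℂ, M * charMatrix C = charMatrix C * Q

/-- The set of all quotients, with respect to the partition with cells `C`, of the
matrices in `𝓑`. -/
def quotient [Fintype ι] [Fintype κ] (𝓑 : Set (Matrix ι ι ℂ)) (C : κ → Set ι) :
    Set (Matrix κ κ ℂ) :=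
  {Q | ∃ M ∈ 𝓑, M * charMatrix C = charMatrix C * Q}

variable {n : ℕ}

/-- The `2n × 2n` matrix `W`, in `n × n` blocks. -/
def matW (A B : Matrix (Fin n) (Fin n) ℂ) : Matrix (Fin n ⊕ Fin n) (Fin n ⊕ Fin n) ℂ :=
  Matrix.fromBlocks Aᵀ (-Aᵀ) (schurInv B)ᵀ (schurInv B)ᵀ

/-- The `4n × 4n` matrix `V`. The four groups of indices `1..n`, `n+1..2n`, `2n+1..3n`,
`3n+1..4n` are `inl ∘ inl`, `inl ∘ inr`, `inr ∘ inl`, `inr ∘ inr`. -/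
def matV (d : ℂ) (A B : Matrix (Fin n) (Fin n) ℂ) :
    Matrix ((Fin n ⊕ Fin n) ⊕ (Fin n ⊕ Fin n)) ((Fin n ⊕ Fin n) ⊕ (Fin n ⊕ Fin n)) ℂ :=
  Matrix.fromBlocks
    (Matrix.fromBlocks (d • A) (-(d • A)) (-(d • A)) (d • A))
    (Matrix.fromBlocks (schurInv B) (schurInv B) (schurInv B) (schurInv B))
    (Matrix.fromBlocks (schurInv B)ᵀ (schurInv B)ᵀ (schurInv B)ᵀ (schurInv B)ᵀ)
    (Matrix.fromBlocks (d • A) (-(d • A)) (-(d • A)) (d • A))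

/-- The cells `{i, n+i}` for `i = 1, …, n` (indexed by `inl`) and `i = 2n+1, …, 3n`
(indexed by `inr`). -/
def pairCells (n : ℕ) : Fin n ⊕ Fin n → Set ((Fin n ⊕ Fin n) ⊕ (Fin n ⊕ Fin n))
  | Sum.inl i => {Sum.inl (Sum.inl i), Sum.inl (Sum.inr i)}
  | Sum.inr i => {Sum.inr (Sum.inl i), Sum.inr (Sum.inr i)}

/-- The pairs do form a partition: every index lies in exactly one cell. -/
theorem existsUnique_mem_pairCells (x : (Fin n ⊕ Fin n) ⊕ (Fin n ⊕ Fin n)) :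
    ∃! k, x ∈ pairCells n k := by
  rcases x with (i | i) | (i | i)
  · exact ⟨Sum.inl i, by simp [pairCells], by rintro (j | j) h <;> simp_all [pairCells]⟩
  · exact ⟨Sum.inl i, by simp [pairCells], by rintro (j | j) h <;> simp_all [pairCells]⟩
  · exact ⟨Sum.inr i, by simp [pairCells], by rintro (j | j) h <;> simp_all [pairCells]⟩
  · exact ⟨Sum.inr i, by simp [pairCells], by rintro (j | j) h <;> simp_all [pairCells]⟩

end JonesPair

end

/-! On pairs of column indices from the same half, the Nomura vectors of `V` are constant on cells:
they are the lifted vectors of `W` (first half) and of a companion `W'` (second half). On mixed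
pairs they change sign within each cell. For a fixed second index the vectors of `W` form a basis,
so every element of `N_V` preserves the cell-constant vectors, and its quotient lies in `N_W`.
Conversely, `cellLift Q` acts as `Q` on cell-constant vectors and kills alternating ones, so what
remains is `N_W ≤ N_{W'}` (`nomura_matW_le`).

That inclusion splits into block-diagonal and block-off-diagonal parts. The diagonal part rests on
an exchange: the braid relation makes the columns of both `D_{Be_k} A` and `D_{Ae_j} B` eigenvectors
of `A`. Conjugating `P` by both diagonal matrices and comparing the two bases shows that `A` and `B`
have the same Nomura algebra; a trace relates the eigenvalues (`mul_eigenvalues`). The off-diagonal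
part is reduced to the diagonal one by multiplying by the matrix with off-diagonal blocks `B`, `Bᵀ`,
which has nonzero eigenvalues on all the vectors concerned. -/

namespace JonesPair

open Matrix

section

/-! ### Commuting elements and conjugation -/

section Commutation

variable {R : Type*} [Monoid R]

/-- Elements that become commuting elements after conjugation by the same unit commute. -/
theorem commute_of_conj {M A U t s : R} (hU : IsUnit U) (hM : M * U = U * t) (hA : A * U = U * s)
    (hts : Commute t s) : Commute M A := by
  apply hU.mul_right_cancel
  rw [mul_assoc, hA, ← mul_assoc, hM, mul_assoc, hts.eq, mul_assoc, hM, ← mul_assoc, ← mul_assoc,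
    hA]

theorem exists_conj_commute {M A U s : R} (hU : IsUnit U) (hA : A * U = U * s)
    (h : Commute M A) : ∃ t, M * U = U * t ∧ Commute t s := by
  obtain ⟨u, rfl⟩ := hU
  refine ⟨↑u⁻¹ * M * u, by simp [mul_assoc], ?_⟩
  apply u.isUnit.mul_left_cancel
  calc (u : R) * (↑u⁻¹ * M * u * s) = M * (u * s) := by simp [mul_assoc]
    _ = A * M * u := by rw [← hA, ← mul_assoc, h.eq]
    _ = A * u * (↑u⁻¹ * M * u) := by simp [mul_assoc]
    _ = u * (s * (↑u⁻¹ * M * u)) := by rw [hA, mul_assoc]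

end Commutation

/-! ### Diagonal conjugates and Nomura eigenvalues -/

variable {ι : Type*}

/-- The conjugate of `P` by the diagonal matrix of column `j` of `C`. -/
noncomputable def colConj (C P : Matrix ι ι ℂ) (j : ι) : Matrix ι ι ℂ :=
  fun x y => C x j * P x y * (C y j)⁻¹

theorem colConj_colConj_comm (A B P : Matrix ι ι ℂ) (j k : ι) :
    colConj B (colConj A P j) k = colConj A (colConj B P k) j := by
  ext x y; simp only [colConj]; ring

variable [Fintype ι]

theorem colConj_mul_apply (C P : Matrix ι ι ℂ) (j x i : ι) :
    (colConj C P j * C) x i = C x j * (P *ᵥ nomuraVec C i j) x := by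
  simp only [Matrix.mul_apply, mulVec, dotProduct, colConj, nomuraVec, schurInv, map_apply,
    Finset.mul_sum]
  exact Finset.sum_congr rfl fun y _ => by ring

/-- `T` is the matrix of eigenvalues of `P` at the vectors `C e_i ∘ C⁽⁻⁾ e_j`. -/
def HasNomuraEigenvalues (P C T : Matrix ι ι ℂ) : Prop :=
  ∀ i j, P *ᵥ nomuraVec C i j = T i j • nomuraVec C i j

variable [DecidableEq ι]

/-- A matrix commuting with the diagonal matrices of all rows of an invertible matrix is
diagonal. -/
theorem eq_diagonal_of_commute_rows {B N : Matrix ι ι ℂ} (hB : IsUnit B)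
    (h : ∀ j, Commute N (diagonal (B j))) : N = diagonal N.diag := by
  ext r s
  by_cases hrs : r = s
  · subst hrs; simp
  rw [diagonal_apply_ne _ hrs]
  by_contra hN
  have hcol : ∀ j, B j r = B j s := by
    intro j
    have := congrFun (congrFun (h j).eq r) s
    rw [mul_diagonal, diagonal_mul, mul_comm] at this
    exact (mul_right_cancel₀ hN this).symm
  have hdet : B.det = 0 := det_zero_of_column_eq hrs hcol
  rw [isUnit_iff_isUnit_det, hdet] at hB
  exact not_isUnit_zero hB

theorem isUnit_diagonal_col {C : Matrix ι ι ℂ} (hC : SchurInvertible C) (j : ι) :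
    IsUnit (diagonal fun x => C x j) := by
  rw [isUnit_diagonal, Pi.isUnit_iff]
  exact fun x => (hC x j).isUnit

/-- Scaling by column `j` turns the vectors with second index `j` into the columns of `C`, so the
eigenvector condition becomes a diagonalisation by `C` itself. -/
theorem hasNomuraEigenvalues_iff {P C T : Matrix ι ι ℂ} (hC : SchurInvertible C) :
    HasNomuraEigenvalues P C T ↔
      ∀ j, colConj C P j * C = C * diagonal fun i => T i j := by
  constructor
  · intro h j
    ext x i
    rw [colConj_mul_apply, h, mul_diagonal]
    simp only [nomuraVec, schurInv, map_apply, Pi.smul_apply, smul_eq_mul]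
    have := hC x j
    field_simp
  · intro h i j
    ext x
    have h1 := congrFun (congrFun (h j) x) i
    rw [colConj_mul_apply, mul_diagonal] at h1
    apply mul_left_cancel₀ (hC x j)
    rw [h1]
    simp only [nomuraVec, schurInv, map_apply, Pi.smul_apply, smul_eq_mul]
    have := hC x j
    field_simp

theorem colConj_mul_diagonal {C : Matrix ι ι ℂ} (hC : SchurInvertible C)
    (P N : Matrix ι ι ℂ) (j : ι) :
    colConj C P j * ((diagonal fun x => C x j) * N) = (diagonal fun x => C x j) * (P * N) := by
  ext x y
  simp only [Matrix.mul_apply (M := colConj C P j), Matrix.mul_apply (M := P), diagonal_mul, colConj, Finset.mul_sum]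
  refine Finset.sum_congr rfl fun z _ => ?_
  have := hC z j
  field_simp

theorem trace_mul_of_conj {M N U : Matrix ι ι ℂ} {s t : ι → ℂ} (hU : IsUnit U)
    (hM : M * U = U * diagonal s) (hN : N * U = U * diagonal t) :
    (M * N).trace = ∑ i, s i * t i := by
  obtain ⟨u, rfl⟩ := hU
  have h1 : M * N = (u : Matrix ι ι ℂ) * (diagonal s * diagonal t) * (↑u⁻¹ : Matrix ι ι ℂ) := by
    rw [← mul_assoc, ← hM, mul_assoc M, ← hN]
    simp [mul_assoc]
  rw [h1, trace_mul_comm, ← mul_assoc, Units.inv_mul, one_mul, diagonal_mul_diagonal,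
    trace_diagonal]

/-! ### The braid relation and the exchange between `A` and `B` -/

/-- The consequences of the braid relation used below. -/
structure BraidPair (A B : Matrix ι ι ℂ) : Prop where
  symm : A.IsSymm
  isUnit_left : IsUnit A
  isUnit_right : IsUnit B
  left_ne : SchurInvertible A
  right_ne : SchurInvertible B
  braid : ∀ i l j, ∑ k, A i k * B k j * A k l = B i j * A i l * B l j

namespace BraidPair

variable {A B : Matrix ι ι ℂ}

theorem comm (h : BraidPair A B) (i j : ι) : A i j = A j i := h.symm.apply j i

theorem mul_col_right (h : BraidPair A B) (k : ι) :
    A * ((diagonal fun x => B x k) * A) =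
      ((diagonal fun x => B x k) * A) * diagonal fun x => B x k := by
  ext i l
  simp only [Matrix.mul_apply (M := A), diagonal_mul, mul_diagonal]
  rw [← h.braid]
  exact Finset.sum_congr rfl fun y _ => by ring

theorem mul_col_left (h : BraidPair A B) (j : ι) :
    A * ((diagonal fun x => A x j) * B) =
      ((diagonal fun x => A x j) * B) * diagonal (B j) := by
  ext i l
  simp only [Matrix.mul_apply (M := A), diagonal_mul, mul_diagonal]
  rw [mul_comm (A i j), ← h.braid]
  exact Finset.sum_congr rfl fun y _ => by ring

theorem isUnit_col_right_mul (h : BraidPair A B) (k : ι) : IsUnit ((diagonal fun x => B x k) * A) :=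
  (isUnit_diagonal_col h.right_ne k).mul h.isUnit_left

theorem isUnit_col_left_mul (h : BraidPair A B) (j : ι) : IsUnit ((diagonal fun x => A x j) * B) :=
  (isUnit_diagonal_col h.left_ne j).mul h.isUnit_right

/-- The basis here also diagonalises `A` by `mul_col_right`, so the double conjugate of `P` commutes
with `A`. -/
theorem conj_left (h : BraidPair A B) {P T : Matrix ι ι ℂ} (hP : HasNomuraEigenvalues P A T) (j k : ι) :
    colConj B (colConj A P j) k * ((diagonal fun x => B x k) * A) =
      ((diagonal fun x => B x k) * A) * diagonal fun i => T i j := by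
  rw [colConj_mul_diagonal h.right_ne, (hasNomuraEigenvalues_iff h.left_ne).1 hP j, mul_assoc]

theorem conj_right (h : BraidPair A B) {P T : Matrix ι ι ℂ} (hP : HasNomuraEigenvalues P B T) (j k : ι) :
    colConj B (colConj A P j) k * ((diagonal fun x => A x j) * B) =
      ((diagonal fun x => A x j) * B) * diagonal fun i => T i k := by
  rw [colConj_colConj_comm, colConj_mul_diagonal h.left_ne,
    (hasNomuraEigenvalues_iff h.right_ne).1 hP k, mul_assoc]

/-- The double conjugate commutes with `A`. In the basis `D_{Ae_j} B` it becomes `N = B⁻¹ (colConj B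
P k) B`, independent of `j`, while `A` becomes the diagonal of row `j` of `B`. Letting `j` vary
forces `N` to be diagonal. -/
theorem exists_right_of_left (h : BraidPair A B) {P T : Matrix ι ι ℂ} (hP : HasNomuraEigenvalues P A T) :
    ∃ T', HasNomuraEigenvalues P B T' := by
  have key : ∀ k, ∃ t : ι → ℂ, colConj B P k * B = B * diagonal t := by
    intro k
    obtain ⟨N, hN⟩ : ∃ N, colConj B P k * B = B * N := by
      obtain ⟨u, hu⟩ := h.isUnit_right
      exact ⟨(↑u⁻¹ : Matrix ι ι ℂ) * (colConj B P k * B), by rw [← hu, ← mul_assoc]; simp⟩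
    refine ⟨N.diag, ?_⟩
    rw [← eq_diagonal_of_commute_rows h.isUnit_right, hN]
    intro j
    have hc : Commute (colConj B (colConj A P j) k) A :=
      commute_of_conj (h.isUnit_col_right_mul k) (h.conj_left hP j k) (h.mul_col_right k)
        (commute_diagonal _ _)
    obtain ⟨t, ht, hts⟩ := exists_conj_commute (h.isUnit_col_left_mul j) (h.mul_col_left j) hc
    rw [colConj_colConj_comm, colConj_mul_diagonal h.left_ne, hN, ← mul_assoc] at ht
    rwa [(h.isUnit_col_left_mul j).mul_left_cancel ht]
  choose t ht using key
  exact ⟨of fun i j => t j i, (hasNomuraEigenvalues_iff h.right_ne).2 ht⟩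

theorem exists_left_of_right (h : BraidPair A B) {P T : Matrix ι ι ℂ} (hP : HasNomuraEigenvalues P B T) :
    ∃ T', HasNomuraEigenvalues P A T' := by
  have key : ∀ j, ∃ t : ι → ℂ, colConj A P j * A = A * diagonal t := by
    intro j
    obtain ⟨N, hN⟩ : ∃ N, colConj A P j * A = A * N := by
      obtain ⟨u, hu⟩ := h.isUnit_left
      exact ⟨(↑u⁻¹ : Matrix ι ι ℂ) * (colConj A P j * A), by rw [← hu, ← mul_assoc]; simp⟩
    refine ⟨N.diag, ?_⟩
    have hBT : IsUnit Bᵀ := by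
      rw [isUnit_iff_isUnit_det, det_transpose, ← isUnit_iff_isUnit_det]
      exact h.isUnit_right
    rw [← eq_diagonal_of_commute_rows hBT, hN]
    intro k
    have hc : Commute (colConj B (colConj A P j) k) A :=
      commute_of_conj (h.isUnit_col_left_mul j) (h.conj_right hP j k) (h.mul_col_left j)
        (commute_diagonal _ _)
    obtain ⟨t, ht, hts⟩ := exists_conj_commute (h.isUnit_col_right_mul k) (h.mul_col_right k) hc
    rw [colConj_mul_diagonal h.right_ne, hN, ← mul_assoc] at ht
    rw [(h.isUnit_col_right_mul k).mul_left_cancel ht]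
    exact hts
  choose t ht using key
  exact ⟨of fun i j => t j i, (hasNomuraEigenvalues_iff h.left_ne).2 ht⟩

/-- The eigenvalue matrices of `P` relative to `A` and `B` are related through `B`. -/
theorem mul_eigenvalues (h : BraidPair A B) {P S T : Matrix ι ι ℂ} (hS : HasNomuraEigenvalues P A S)
    (hT : HasNomuraEigenvalues P B T) : B * T = Sᵀ * B := by
  ext j k
  -- The trace of the double conjugate times `A`, computed in the two eigenbases.
  have h1 := trace_mul_of_conj (h.isUnit_col_right_mul k) (h.conj_left hS j k) (h.mul_col_right k)
  have h2 := trace_mul_of_conj (h.isUnit_col_left_mul j) (h.conj_right hT j k) (h.mul_col_left j)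
  rw [h1] at h2
  simp only [Matrix.mul_apply, transpose_apply]
  rw [h2]
  exact Finset.sum_congr rfl fun _ _ => mul_comm _ _

end BraidPair

end

/-! ### Type II property and its consequences -/

section

variable {ι : Type*} [Fintype ι] [DecidableEq ι]

/-- `C` is a type II matrix: `C⁽⁻⁾ᵀ C = n I`. -/
def IsTypeII (C : Matrix ι ι ℂ) : Prop := (schurInv C)ᵀ * C = (Fintype.card ι : ℂ) • 1

theorem IsTypeII.mul_schurInv_transpose {C : Matrix ι ι ℂ} (hC : IsTypeII C) :
    C * (schurInv C)ᵀ = (Fintype.card ι : ℂ) • 1 := by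
  rcases isEmpty_or_nonempty ι with hι | hι
  · exact Subsingleton.elim _ _
  have hn : (Fintype.card ι : ℂ) ≠ 0 := by exact_mod_cast Fintype.card_ne_zero
  have h1 : ((Fintype.card ι : ℂ)⁻¹ • (schurInv C)ᵀ) * C = 1 := by
    rw [smul_mul_assoc, hC, smul_smul, inv_mul_cancel₀ hn, one_smul]
  have h2 := mul_eq_one_comm.1 h1
  rw [mul_smul_comm] at h2
  rw [← h2, smul_smul, mul_inv_cancel₀ hn, one_smul]

/-- For type II `C`, the rows of `C⁽⁻⁾ᵀ` are multiples of the rows of `C⁻¹`, hence left eigenvectors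
of `colConj C P i`; undoing the scaling gives eigenvectors of `Pᵀ` with the two indices swapped. -/
theorem IsTypeII.transpose_eigenvalues {C P T : Matrix ι ι ℂ} (hC : IsTypeII C)
    (hne : SchurInvertible C) (hP : HasNomuraEigenvalues P C T) :
    HasNomuraEigenvalues Pᵀ C Tᵀ := by
  rcases isEmpty_or_nonempty ι with hι | hι
  · exact fun i => hι.elim i
  have hn : (Fintype.card ι : ℂ) ≠ 0 := by exact_mod_cast Fintype.card_ne_zero
  rw [hasNomuraEigenvalues_iff hne] at hP
  intro i j
  have h1 : (Fintype.card ι : ℂ) • (schurInv C)ᵀ * colConj C P i =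
      (Fintype.card ι : ℂ) • (diagonal (fun r => T r i) * (schurInv C)ᵀ) := by
    calc (Fintype.card ι : ℂ) • (schurInv C)ᵀ * colConj C P i
        = (schurInv C)ᵀ * (colConj C P i * (C * (schurInv C)ᵀ)) := by
          rw [hC.mul_schurInv_transpose]; simp
      _ = (schurInv C)ᵀ * C * (diagonal (fun r => T r i) * (schurInv C)ᵀ) := by
          rw [← mul_assoc (colConj C P i), hP i]; simp only [mul_assoc]
      _ = _ := by rw [hC]; simp
  ext x
  have h2 := congrFun (congrFun h1 j) x
  simp only [smul_mul_assoc, Matrix.smul_apply, smul_eq_mul, diagonal_mul] at h2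
  have h3 := mul_left_cancel₀ hn h2
  simp only [Matrix.mul_apply, transpose_apply, schurInv, map_apply, colConj] at h3
  simp only [mulVec, dotProduct, transpose_apply, nomuraVec, schurInv, map_apply, Pi.smul_apply,
    smul_eq_mul]
  rw [mul_left_comm, ← h3, Finset.mul_sum]
  refine Finset.sum_congr rfl fun y _ => ?_
  have := hne x i
  field_simp

namespace BraidPair

variable {A B : Matrix ι ι ℂ}

theorem isTypeII_right (h : BraidPair A B) : IsTypeII B := by
  obtain ⟨u, hu⟩ := h.isUnit_right
  obtain ⟨C, hCB, hBC⟩ : ∃ C : Matrix ι ι ℂ, C * B = 1 ∧ B * C = 1 :=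
    ⟨(↑u⁻¹ : Matrix ι ι ℂ), by rw [← hu]; simp, by rw [← hu]; simp⟩
  -- Diagonal entries of `A = D_{Ae_j} B D (D_{Ae_j} B)⁻¹`, with `D` the diagonal of row `j` of `B`,
  -- do not see the outer scaling; the left side does not depend on `j`.
  have hv : ∀ k, (B *ᵥ fun r => B k r * C r k) = fun _ => A k k := by
    intro k
    ext j
    have h1 : A * (diagonal fun x => A x j) =
        ((diagonal fun x => A x j) * B) * (diagonal (B j) * C) := by
      rw [← mul_assoc, ← h.mul_col_left j, mul_assoc, mul_assoc, hBC, mul_one]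
    have h2 := congrFun (congrFun h1 k) k
    rw [mul_diagonal, mul_assoc, diagonal_mul, mul_comm] at h2
    rw [mul_left_cancel₀ (h.left_ne k j) h2, Matrix.mul_apply]
    simp only [mulVec, dotProduct, diagonal_mul]
    exact Finset.sum_congr rfl fun _ _ => by ring
  have hw : ∀ k r, B k r * C r k = A k k * (C *ᵥ 1) r := by
    intro k r
    have h1 : (fun r => B k r * C r k) = A k k • (C *ᵥ 1) := by
      calc (fun r => B k r * C r k) = C *ᵥ (B *ᵥ fun r => B k r * C r k) := by
            rw [mulVec_mulVec, hCB, one_mulVec]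
        _ = C *ᵥ (A k k • 1) := by rw [hv]; congr 1; ext; simp
        _ = _ := by rw [mulVec_smul]
    exact congrFun h1 r
  -- Summing over `r` gives a diagonal entry of `B * C = 1`, so `A` has constant diagonal and `B k r
  -- * C r k` does not depend on `k`.
  have hsum : ∀ k, A k k * ∑ r, (C *ᵥ 1) r = 1 := by
    intro k
    have := congrFun (congrFun hBC k) k
    rw [Matrix.mul_apply, one_apply_eq] at this
    rw [Finset.mul_sum, ← this]
    exact Finset.sum_congr rfl fun r _ => (hw k r).symm
  have hconst : ∀ k, A k k = (∑ r, (C *ᵥ 1) r)⁻¹ := fun k => eq_inv_of_mul_eq_one_left (hsum k)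
  have hone : ∀ k r, (Fintype.card ι : ℂ) * (B k r * C r k) = 1 := by
    intro k r
    have := congrFun (congrFun hCB r) r
    rw [Matrix.mul_apply, one_apply_eq] at this
    rw [← this, hw, hconst k]
    rw [Finset.sum_congr rfl fun l _ => (mul_comm _ _).trans ((hw l r).trans (by rw [hconst l]))]
    simp
  have : (schurInv B)ᵀ = (Fintype.card ι : ℂ) • C := by
    ext r k
    have := hone k r
    simp only [transpose_apply, schurInv, map_apply, Matrix.smul_apply, smul_eq_mul]
    exact inv_eq_of_mul_eq_one_right (by linear_combination this)
  rw [IsTypeII, this, smul_mul_assoc, hCB]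

theorem isTypeII_left (h : BraidPair A B) : IsTypeII A := by
  obtain ⟨u, hu⟩ := h.isUnit_left
  obtain ⟨C, hCA, hAC⟩ : ∃ C : Matrix ι ι ℂ, C * A = 1 ∧ A * C = 1 :=
    ⟨(↑u⁻¹ : Matrix ι ι ℂ), by rw [← hu]; simp, by rw [← hu]; simp⟩
  -- This expresses `A⁻¹` in the eigenbasis `D_{Ae_i} B`. The sum on the right is symmetric in `i`
  -- and `l`, and comparing both versions makes `C k l * A k l` independent of `l`.
  have hs : ∀ k i l, (Fintype.card ι : ℂ) * (C k l * A l i) =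
      A k i * ∑ r, B k r * (B i r)⁻¹ * (B l r)⁻¹ := by
    intro k i l
    have hdiag : diagonal (B i) * diagonal (fun r => (B i r)⁻¹) = 1 := by
      rw [diagonal_mul_diagonal, ← diagonal_one]
      congr 1; ext r; exact mul_inv_cancel₀ (h.right_ne i r)
    have h1 : (Fintype.card ι : ℂ) • (C * (diagonal fun x => A x i)) =
        (diagonal fun x => A x i) * (B * diagonal (fun r => (B i r)⁻¹) * (schurInv B)ᵀ) := by
      calc (Fintype.card ι : ℂ) • (C * (diagonal fun x => A x i))
          = C * ((diagonal fun x => A x i) * (B * (diagonal (B i) *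
              diagonal (fun r => (B i r)⁻¹)) * (schurInv B)ᵀ)) := by
            rw [hdiag, mul_one, h.isTypeII_right.mul_schurInv_transpose]; simp
        _ = C * (((diagonal fun x => A x i) * B) * diagonal (B i)) *
              (diagonal (fun r => (B i r)⁻¹) * (schurInv B)ᵀ) := by simp only [mul_assoc]
        _ = _ := by
            rw [← h.mul_col_left i, ← mul_assoc C, hCA]; simp only [mul_assoc, one_mul]
    have h2 := congrFun (congrFun h1 k) l
    rw [Matrix.smul_apply, mul_diagonal, diagonal_mul, Matrix.mul_apply] at h2
    simpa only [mul_diagonal, transpose_apply, schurInv, map_apply, smul_eq_mul] using h2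
  have hconst : ∀ k i l, (Fintype.card ι : ℂ) * (C k l * A k l) =
      (Fintype.card ι : ℂ) * (C k i * A k i) := by
    intro k i l
    have h1 := hs k i l
    have h2 := hs k l i
    have h3 : ∑ r, B k r * (B l r)⁻¹ * (B i r)⁻¹ = ∑ r, B k r * (B i r)⁻¹ * (B l r)⁻¹ :=
      Finset.sum_congr rfl fun r _ => by ring
    rw [h3, h.comm i l] at h2
    apply mul_right_cancel₀ (h.left_ne l i)
    linear_combination A k l * h1 - A k i * h2
  have hone : ∀ k l, (Fintype.card ι : ℂ) * (C k l * A k l) = 1 := by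
    intro k l
    have hn : (Fintype.card ι : ℂ) ≠ 0 := by
      have : Nonempty ι := ⟨k⟩
      exact_mod_cast Fintype.card_ne_zero
    have := congrFun (congrFun hCA k) k
    have hsum : ∑ i, C k i * A i k = ∑ _i : ι, C k l * A k l :=
      Finset.sum_congr rfl fun i _ => by
        rw [h.comm i k]; exact mul_left_cancel₀ hn (hconst k l i)
    rw [Matrix.mul_apply, one_apply_eq, hsum] at this
    simpa using this
  have : (schurInv A)ᵀ = (Fintype.card ι : ℂ) • C := by
    ext r k
    have := hone r k
    simp only [transpose_apply, schurInv, map_apply, Matrix.smul_apply, smul_eq_mul]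
    rw [h.comm k r]
    exact inv_eq_of_mul_eq_one_right (by linear_combination this)
  rw [IsTypeII, this, smul_mul_assoc, hCA]

/-- Dividing the braid relation by `B i y` and summing over `y` collapses the sum over `k` to `k =
i`, since `B` is type II. -/
theorem mulVec_nomuraVec_transpose (h : BraidPair A B) (i j : ι) :
    B *ᵥ nomuraVec Bᵀ j i = ((Fintype.card ι : ℂ) * A i j) • nomuraVec A i j := by
  ext x
  simp only [mulVec, dotProduct, transpose_apply, nomuraVec, schurInv, map_apply, Pi.smul_apply,
    smul_eq_mul]
  have h1 : ∑ y, (∑ k, A x k * B k y * A k j) * (B i y)⁻¹ =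
      (Fintype.card ι : ℂ) * (A x i * A i j) := by
    simp only [Finset.sum_mul]
    rw [Finset.sum_comm]
    have h2 : ∀ k, ∑ y, A x k * B k y * A k j * (B i y)⁻¹ =
        A x k * A k j * (B * (schurInv B)ᵀ) k i := by
      intro k
      rw [Matrix.mul_apply, Finset.mul_sum]
      exact Finset.sum_congr rfl fun y _ => by
        simp only [transpose_apply, schurInv, map_apply]; ring
    simp only [h2, h.isTypeII_right.mul_schurInv_transpose]
    simp [one_apply, mul_comm]
  simp only [h.braid] at h1
  have := h.left_ne x j
  rw [← mul_assoc, ← div_eq_mul_inv, eq_div_iff this]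
  rw [Finset.sum_mul]
  rw [mul_assoc, mul_comm (A i j), ← h1]
  exact Finset.sum_congr rfl fun y _ => by ring

/-- This is `mul_col_right` multiplied on the left by `A⁽⁻⁾ᵀ`, which is `n A⁻¹`. -/
theorem transpose_mulVec_nomuraVec (h : BraidPair A B) (i j : ι) :
    Bᵀ *ᵥ nomuraVec A i j = ((Fintype.card ι : ℂ) * A i j) • nomuraVec Bᵀ j i := by
  ext x
  have h1 : (Fintype.card ι : ℂ) • ((diagonal fun y => B y x) * A) =
      (schurInv A)ᵀ * (((diagonal fun y => B y x) * A) * diagonal fun y => B y x) := by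
    rw [← h.mul_col_right, ← mul_assoc, h.isTypeII_left]; simp
  have h2 := congrFun (congrFun h1 j) i
  rw [Matrix.mul_apply] at h2
  simp only [Matrix.smul_apply, diagonal_mul, mul_diagonal, transpose_apply, schurInv,
    map_apply, smul_eq_mul] at h2
  simp only [mulVec, dotProduct, transpose_apply, nomuraVec, schurInv, map_apply, Pi.smul_apply,
    smul_eq_mul]
  rw [← mul_assoc, ← div_eq_mul_inv, eq_div_iff (h.right_ne i x), Finset.sum_mul, h.comm i j,
    mul_right_comm, mul_assoc, h2]
  exact Finset.sum_congr rfl fun y _ => by ring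

/-- Matrices whose eigenvalues at the vectors of `A` and `Bᵀ` are transposes of each other
have the same property, in the opposite order, at the vectors of `B` and `A`. -/
theorem exists_eigenvalues_swap (h : BraidPair A B) (h' : BraidPair A Bᵀ)
    {P P' T : Matrix ι ι ℂ} (hP : HasNomuraEigenvalues P A T)
    (hP' : HasNomuraEigenvalues P' Bᵀ Tᵀ) :
    ∃ S, HasNomuraEigenvalues P B Sᵀ ∧ HasNomuraEigenvalues P' A S := by
  obtain ⟨Φ, hΦ⟩ := h.exists_right_of_left hP
  obtain ⟨S, hS⟩ := h'.exists_left_of_right hP'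
  have h1 := h.mul_eigenvalues (h.isTypeII_left.transpose_eigenvalues h.left_ne hP)
    (h.isTypeII_right.transpose_eigenvalues h.right_ne hΦ)
  have h2 := congrArg Matrix.transpose (h'.mul_eigenvalues hS hP')
  simp only [transpose_mul, transpose_transpose] at h1 h2
  -- The relation for `Pᵀ` and the pair `(A, B)`, and the one for `P'` and `(A, Bᵀ)`, both evaluate
  -- to `T * B`.
  have h3 : S = Φᵀ := h.isUnit_right.mul_left_cancel (by rw [h1, h2])
  exact ⟨S, by rwa [h3, transpose_transpose], hS⟩

end BraidPair

end

/-! ### From Jones pairs to the entrywise braid relation -/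

section

section

variable {ι : Type*} [Fintype ι] [DecidableEq ι] {A B : Matrix ι ι ℂ}

theorem IsOneSidedJonesPair.braidPair (h : IsOneSidedJonesPair A B) (hA : A.IsSymm)
    (hne : SchurInvertible A) (hB : IsUnit B) : BraidPair A B where
  symm := hA
  isUnit_left := by
    obtain ⟨M, hM⟩ := ((Module.End.isUnit_iff _).1 h.isUnit_opX).2 1
    exact IsUnit.of_mul_eq_one M hM
  isUnit_right := hB
  left_ne := hne
  right_ne i j h0 := by
    obtain ⟨M, hM⟩ := ((Module.End.isUnit_iff _).1 h.isUnit_opΔ).2 (of fun _ _ => 1)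
    have h1 := congrFun (congrFun hM i) j
    simp [opΔ, hadamard_apply, h0] at h1
  braid i l j := by
    -- Evaluating the operator identity at the matrix unit `E_{lj}` and reading off entry `(i, j)`
    -- gives the scalar relation.
    have h1 := congrFun (congrFun (LinearMap.congr_fun h.braid (Matrix.single l j 1)) i) j
    simp only [Module.End.mul_apply, opX, opΔ, LinearMap.coe_mk, AddHom.coe_mk,
      hadamard_apply, Matrix.mul_apply, single_apply] at h1
    simpa [mul_assoc] using h1

end

theorem IsInvertibleJonesPair.braidPair {ι : Type*} [Fintype ι] [DecidableEq ι]
    {A B : Matrix ι ι ℂ} (h : IsInvertibleJonesPair A B) (hA : A.IsSymm) : BraidPair A B :=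
  h.left.braidPair hA h.schurInvertible h.isUnit

theorem IsInvertibleJonesPair.braidPair_transpose {ι : Type*} [Fintype ι] [DecidableEq ι]
    {A B : Matrix ι ι ℂ} (h : IsInvertibleJonesPair A B) (hA : A.IsSymm) : BraidPair A Bᵀ :=
  h.right.braidPair hA h.schurInvertible (by
    rw [isUnit_iff_isUnit_det, det_transpose, ← isUnit_iff_isUnit_det]; exact h.isUnit)

/-! ### The matrix `W` and its companion -/

variable {n : ℕ} {A B : Matrix (Fin n) (Fin n) ℂ}

/-- The companion of `W`, whose columns give the remaining symmetric vectors of `V`. -/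
noncomputable def matW' (A B : Matrix (Fin n) (Fin n) ℂ) :
    Matrix (Fin n ⊕ Fin n) (Fin n ⊕ Fin n) ℂ :=
  fromBlocks (schurInv B) (schurInv B) A (-A)

theorem exists_eigen_neg {ι : Type*} [Fintype ι] {Q : Matrix ι ι ℂ} {v : ι → ℂ}
    (h : ∃ c : ℂ, Q *ᵥ v = c • v) : ∃ c : ℂ, Q *ᵥ (-v) = c • (-v) := by
  obtain ⟨c, hc⟩ := h
  exact ⟨c, by rw [mulVec_neg, hc, smul_neg]⟩

/-- Up to an overall sign, the four choices of block columns yield only the two vectors with `s =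
±1`. -/
theorem mem_nomura_matW_iff (hA : A.IsSymm) {Q : Matrix (Fin n ⊕ Fin n) (Fin n ⊕ Fin n) ℂ} :
    Q ∈ nomura (matW A B) ↔ ∀ i j, ∀ s : ℂ, s * s = 1 →
      ∃ c : ℂ, Q *ᵥ Sum.elim (nomuraVec A i j) (s • nomuraVec Bᵀ j i) =
        c • Sum.elim (nomuraVec A i j) (s • nomuraVec Bᵀ j i) := by
  have e1 : ∀ i j, nomuraVec (matW A B) (Sum.inl i) (Sum.inl j) =
      Sum.elim (nomuraVec A i j) ((1 : ℂ) • nomuraVec Bᵀ j i) := by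
    intro i j
    ext (x | x) <;> simp [nomuraVec, matW, schurInv, hA.apply, mul_comm]
  have e2 : ∀ i j, nomuraVec (matW A B) (Sum.inl i) (Sum.inr j) =
      -Sum.elim (nomuraVec A i j) ((-1 : ℂ) • nomuraVec Bᵀ j i) := by
    intro i j
    ext (x | x) <;> simp [nomuraVec, matW, schurInv, hA.apply, mul_comm, inv_neg]
  have e3 : ∀ i j, nomuraVec (matW A B) (Sum.inr i) (Sum.inl j) =
      -Sum.elim (nomuraVec A i j) ((-1 : ℂ) • nomuraVec Bᵀ j i) := by
    intro i j
    ext (x | x) <;> simp [nomuraVec, matW, schurInv, hA.apply, mul_comm]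
  have e4 : ∀ i j, nomuraVec (matW A B) (Sum.inr i) (Sum.inr j) =
      Sum.elim (nomuraVec A i j) ((1 : ℂ) • nomuraVec Bᵀ j i) := by
    intro i j
    ext (x | x) <;> simp [nomuraVec, matW, schurInv, hA.apply, mul_comm, inv_neg]
  constructor
  · intro h i j s hs
    rcases mul_self_eq_one_iff.1 hs with rfl | rfl
    · simpa only [e1] using h (Sum.inl i) (Sum.inl j)
    · have := exists_eigen_neg (h (Sum.inl i) (Sum.inr j))
      simpa only [e2, neg_neg] using this
  · rintro h (i | i) (j | j)
    · rw [e1]; exact h i j 1 (by simp)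
    · rw [e2]; exact exists_eigen_neg (h i j (-1) (by simp))
    · rw [e3]; exact exists_eigen_neg (h i j (-1) (by simp))
    · rw [e4]; exact h i j 1 (by simp)

theorem mem_nomura_matW'_iff {Q : Matrix (Fin n ⊕ Fin n) (Fin n ⊕ Fin n) ℂ} :
    Q ∈ nomura (matW' A B) ↔ ∀ i j, ∀ s : ℂ, s * s = 1 →
      ∃ c : ℂ, Q *ᵥ Sum.elim (nomuraVec B j i) (s • nomuraVec A i j) =
        c • Sum.elim (nomuraVec B j i) (s • nomuraVec A i j) := by
  have e1 : ∀ i j, nomuraVec (matW' A B) (Sum.inl i) (Sum.inl j) =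
      Sum.elim (nomuraVec B j i) ((1 : ℂ) • nomuraVec A i j) := by
    intro i j
    ext (x | x) <;> simp [nomuraVec, matW', schurInv, mul_comm]
  have e2 : ∀ i j, nomuraVec (matW' A B) (Sum.inl i) (Sum.inr j) =
      Sum.elim (nomuraVec B j i) ((-1 : ℂ) • nomuraVec A i j) := by
    intro i j
    ext (x | x) <;> simp [nomuraVec, matW', schurInv, mul_comm, inv_neg]
  have e3 : ∀ i j, nomuraVec (matW' A B) (Sum.inr i) (Sum.inl j) =
      Sum.elim (nomuraVec B j i) ((-1 : ℂ) • nomuraVec A i j) := by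
    intro i j
    ext (x | x) <;> simp [nomuraVec, matW', schurInv, mul_comm]
  have e4 : ∀ i j, nomuraVec (matW' A B) (Sum.inr i) (Sum.inr j) =
      Sum.elim (nomuraVec B j i) ((1 : ℂ) • nomuraVec A i j) := by
    intro i j
    ext (x | x) <;> simp [nomuraVec, matW', schurInv, mul_comm, inv_neg]
  constructor
  · intro h i j s hs
    rcases mul_self_eq_one_iff.1 hs with rfl | rfl
    · simpa only [e1] using h (Sum.inl i) (Sum.inl j)
    · simpa only [e2] using h (Sum.inl i) (Sum.inr j)
  · rintro h (i | i) (j | j)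
    · rw [e1]; exact h i j 1 (by simp)
    · rw [e2]; exact h i j (-1) (by simp)
    · rw [e3]; exact h i j (-1) (by simp)
    · rw [e4]; exact h i j 1 (by simp)

/-- Conjugation by `diag(1, -1)` exchanges the vectors for `s` and `-s`, hence preserves `N_W`; the
two parts are half the sum and half the difference of the matrix and its conjugate. -/
theorem fromBlocks_mem_nomura_matW (hA : A.IsSymm) {P R R' P' : Matrix (Fin n) (Fin n) ℂ}
    (hQ : fromBlocks P R R' P' ∈ nomura (matW A B)) :
    fromBlocks P 0 0 P' ∈ nomura (matW A B) ∧ fromBlocks 0 R R' 0 ∈ nomura (matW A B) := by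
  have hneg : fromBlocks P (-R) (-R') P' ∈ nomura (matW A B) := by
    rw [mem_nomura_matW_iff hA] at hQ ⊢
    intro i j s hs
    obtain ⟨c, hc⟩ := hQ i j (-s) (by rw [neg_mul_neg, hs])
    refine ⟨c, ?_⟩
    rw [fromBlocks_mulVec] at hc ⊢
    ext (x | x)
    · have := congrFun hc (Sum.inl x)
      simpa [neg_mulVec, mulVec_neg] using this
    · have := congrFun hc (Sum.inr x)
      simp [neg_mulVec, mulVec_neg] at this ⊢
      linear_combination -this
  constructor
  · convert (nomura (matW A B)).smul_mem ((nomura (matW A B)).add_mem hQ hneg) (2⁻¹ : ℂ) using 1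
    ext (x | x) (y | y) <;> simp <;> ring
  · convert (nomura (matW A B)).smul_mem ((nomura (matW A B)).sub_mem hQ hneg) (2⁻¹ : ℂ) using 1
    ext (x | x) (y | y) <;> simp <;> ring

theorem fromBlocks_diag_mem_nomura_matW' (h : BraidPair A B) (h' : BraidPair A Bᵀ)
    {P P' : Matrix (Fin n) (Fin n) ℂ} (hQ : fromBlocks P 0 0 P' ∈ nomura (matW A B)) :
    fromBlocks P 0 0 P' ∈ nomura (matW' A B) := by
  rw [mem_nomura_matW_iff h.symm] at hQ
  choose c hc using fun i j => hQ i j 1 (one_mul 1)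
  obtain ⟨S, hS, hS'⟩ := h.exists_eigenvalues_swap h' (P := P) (P' := P') (T := of c)
    (by
      intro i j
      ext x
      simpa [fromBlocks_mulVec] using congrFun (hc i j) (Sum.inl x))
    (by
      intro i j
      ext x
      simpa [fromBlocks_mulVec] using congrFun (hc j i) (Sum.inr x))
  rw [mem_nomura_matW'_iff]
  refine fun i j s _ => ⟨S i j, ?_⟩
  ext (x | x)
  · simpa [fromBlocks_mulVec] using congrFun (hS j i) x
  · have := congrFun (hS' i j) x
    simp only [Pi.smul_apply, smul_eq_mul] at this
    simp [fromBlocks_mulVec, mulVec_smul, this]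
    ring

theorem fromBlocks_off_mulVec (h : BraidPair A B) (i j : Fin n) {s : ℂ} (hs : s * s = 1) :
    fromBlocks 0 B Bᵀ 0 *ᵥ Sum.elim (nomuraVec A i j) (s • nomuraVec Bᵀ j i) =
      (s * (n * A i j)) • Sum.elim (nomuraVec A i j) (s • nomuraVec Bᵀ j i) := by
  ext (x | x)
  · simp [fromBlocks_mulVec, mulVec_smul, h.mulVec_nomuraVec_transpose]
    ring
  · simp [fromBlocks_mulVec, h.transpose_mulVec_nomuraVec]
    linear_combination (-(n * A i j * nomuraVec Bᵀ j i x)) * hs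

theorem fromBlocks_off_mulVec' (h' : BraidPair A Bᵀ) (i j : Fin n) {s : ℂ} (hs : s * s = 1) :
    fromBlocks 0 B Bᵀ 0 *ᵥ Sum.elim (nomuraVec B j i) (s • nomuraVec A i j) =
      (s * (n * A i j)) • Sum.elim (nomuraVec B j i) (s • nomuraVec A i j) := by
  have h1 := h'.mulVec_nomuraVec_transpose i j
  have h2 := h'.transpose_mulVec_nomuraVec i j
  rw [transpose_transpose] at h1 h2
  ext (x | x)
  · simp [fromBlocks_mulVec, mulVec_smul, h2]
    ring
  · simp [fromBlocks_mulVec, h1]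
    linear_combination (-(n * A i j * nomuraVec A i j x)) * hs

theorem nomura_matW_le (h : BraidPair A B) (h' : BraidPair A Bᵀ) :
    nomura (matW A B) ≤ nomura (matW' A B) := by
  intro Q hQ
  obtain ⟨P, R, R', P', rfl⟩ : ∃ P R R' P', Q = fromBlocks P R R' P' :=
    ⟨_, _, _, _, (fromBlocks_toBlocks Q).symm⟩
  obtain ⟨hd, ho⟩ := fromBlocks_mem_nomura_matW h.symm hQ
  have hB : fromBlocks 0 B Bᵀ 0 ∈ nomura (matW A B) := by
    rw [mem_nomura_matW_iff h.symm]
    exact fun i j s hs => ⟨_, fromBlocks_off_mulVec h i j hs⟩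
  have hprod := (nomura (matW A B)).mul_mem ho hB
  rw [fromBlocks_multiply] at hprod
  simp only [Matrix.zero_mul, Matrix.mul_zero, zero_add, add_zero] at hprod
  have hprod' := fromBlocks_diag_mem_nomura_matW' h h' hprod
  have ho' : fromBlocks 0 R R' 0 ∈ nomura (matW' A B) := by
    rw [mem_nomura_matW'_iff] at hprod' ⊢
    intro i j s hs
    obtain ⟨c, hc⟩ := hprod' i j s hs
    have hne : s * (n * A i j) ≠ 0 := by
      have : s ≠ 0 := by rintro rfl; simp at hs
      have : (n : ℂ) ≠ 0 := by
        have := Fin.pos i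
        exact_mod_cast this.ne'
      have := h.left_ne i j
      positivity
    -- The right factor acts on each vector of `W'` by the nonzero scalar above, which can be
    -- cancelled.
    have hm : fromBlocks (R * Bᵀ) 0 0 (R' * B) =
        fromBlocks 0 R R' 0 * fromBlocks 0 B Bᵀ 0 := by
      rw [fromBlocks_multiply]; simp
    rw [hm, ← mulVec_mulVec, fromBlocks_off_mulVec' h' i j hs, mulVec_smul] at hc
    refine ⟨(s * (n * A i j))⁻¹ * c, ?_⟩
    rw [mul_smul, ← hc, smul_smul, inv_mul_cancel₀ hne, one_smul]
  convert (nomura (matW' A B)).add_mem (fromBlocks_diag_mem_nomura_matW' h h' hd) ho' using 1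
  rw [fromBlocks_add]; simp

end

/-! ### The matrix `V` and the quotient -/

variable {n : ℕ} {A B : Matrix (Fin n) (Fin n) ℂ}

/-- The cell that contains a given index. -/
def cellOf : (Fin n ⊕ Fin n) ⊕ (Fin n ⊕ Fin n) → Fin n ⊕ Fin n :=
  Sum.map (Sum.elim id id) (Sum.elim id id)

theorem charMatrix_pairCells_apply (x : (Fin n ⊕ Fin n) ⊕ (Fin n ⊕ Fin n)) (k : Fin n ⊕ Fin n) :
    charMatrix (pairCells n) x k = if cellOf x = k then 1 else 0 := by
  classical
  have : x ∈ pairCells n k ↔ cellOf x = k := by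
    rcases x with (i | i) | (i | i) <;> rcases k with k | k <;>
      simp [pairCells, cellOf]
  simp [charMatrix, this]

theorem charMatrix_mulVec (v : Fin n ⊕ Fin n → ℂ) :
    charMatrix (pairCells n) *ᵥ v = v ∘ cellOf := by
  ext x
  simp [mulVec, dotProduct, charMatrix_pairCells_apply]

theorem comp_cellOf_injective :
    Function.Injective fun v : Fin n ⊕ Fin n → ℂ => v ∘ (cellOf (n := n)) := by
  intro v w hvw
  ext (i | i)
  · exact congrFun hvw (Sum.inl (Sum.inl i))
  · exact congrFun hvw (Sum.inr (Sum.inl i))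

/-- Entries are ratios within one row, so the factor `d` cancels; the two rows of a cell differ at
most by a common sign, which cancels too. -/
theorem nomuraVec_matV_inl {d : ℂ} (hd : d ≠ 0) (hA : A.IsSymm) (a b : Fin n ⊕ Fin n) :
    nomuraVec (matV d A B) (Sum.inl a) (Sum.inl b) = nomuraVec (matW A B) a b ∘ cellOf := by
  ext ((x | x) | (x | x)) <;> rcases a with i | i <;> rcases b with j | j <;>
    simp [nomuraVec, matV, matW, schurInv, cellOf, hA.apply, inv_neg] <;> field_simp

theorem nomuraVec_matV_inr {d : ℂ} (hd : d ≠ 0) (a b : Fin n ⊕ Fin n) :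
    nomuraVec (matV d A B) (Sum.inr a) (Sum.inr b) = nomuraVec (matW' A B) a b ∘ cellOf := by
  ext ((x | x) | (x | x)) <;> rcases a with i | i <;> rcases b with j | j <;>
    simp [nomuraVec, matV, matW', schurInv, cellOf, inv_neg] <;> field_simp

/-- A vector that changes sign between the two elements of each cell. -/
def IsAlternating (v : (Fin n ⊕ Fin n) ⊕ (Fin n ⊕ Fin n) → ℂ) : Prop :=
  ∀ k, v (Sum.inl (Sum.inr k)) = -v (Sum.inl (Sum.inl k)) ∧
    v (Sum.inr (Sum.inr k)) = -v (Sum.inr (Sum.inl k))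

theorem isAlternating_nomuraVec_matV_inl_inr (d : ℂ) (a b : Fin n ⊕ Fin n) :
    IsAlternating (nomuraVec (matV d A B) (Sum.inl a) (Sum.inr b)) := by
  intro k
  rcases a with i | i <;> rcases b with j | j <;>
    simp [nomuraVec, matV, schurInv, inv_neg]

theorem isAlternating_nomuraVec_matV_inr_inl (d : ℂ) (a b : Fin n ⊕ Fin n) :
    IsAlternating (nomuraVec (matV d A B) (Sum.inr a) (Sum.inl b)) := by
  intro k
  rcases a with i | i <;> rcases b with j | j <;>
    simp [nomuraVec, matV, schurInv, inv_neg]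

/-- The matrix that acts as `Q` on vectors constant on cells and annihilates alternating
vectors. -/
noncomputable def cellLift (Q : Matrix (Fin n ⊕ Fin n) (Fin n ⊕ Fin n) ℂ) :
    Matrix ((Fin n ⊕ Fin n) ⊕ (Fin n ⊕ Fin n)) ((Fin n ⊕ Fin n) ⊕ (Fin n ⊕ Fin n)) ℂ :=
  -- The factor `2⁻¹` compensates for the two indices in each cell.
  of fun x y => 2⁻¹ * Q (cellOf x) (cellOf y)

theorem cellLift_mulVec_comp (Q : Matrix (Fin n ⊕ Fin n) (Fin n ⊕ Fin n) ℂ)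
    (v : Fin n ⊕ Fin n → ℂ) : cellLift Q *ᵥ (v ∘ cellOf) = (Q *ᵥ v) ∘ cellOf := by
  ext x
  simp only [mulVec, dotProduct, cellLift, of_apply, Function.comp_apply, Fintype.sum_sum_type,
    cellOf, Sum.map_inl, Sum.map_inr, Sum.elim_inl, Sum.elim_inr, id, mul_assoc,
    ← Finset.mul_sum]
  ring

theorem cellLift_mulVec_of_isAlternating (Q : Matrix (Fin n ⊕ Fin n) (Fin n ⊕ Fin n) ℂ)
    {v : (Fin n ⊕ Fin n) ⊕ (Fin n ⊕ Fin n) → ℂ} (hv : IsAlternating v) :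
    cellLift Q *ᵥ v = 0 := by
  ext x
  simp [mulVec, dotProduct, cellLift, Fintype.sum_sum_type, cellOf, (hv _).1, (hv _).2]

theorem cellLift_mul_charMatrix (Q : Matrix (Fin n ⊕ Fin n) (Fin n ⊕ Fin n) ℂ) :
    cellLift Q * charMatrix (pairCells n) = charMatrix (pairCells n) * Q := by
  apply ext_of_mulVec_single
  intro i
  rw [← mulVec_mulVec, ← mulVec_mulVec, charMatrix_mulVec, charMatrix_mulVec,
    cellLift_mulVec_comp]

theorem cellLift_mem_nomura {d : ℂ} (hd : d ≠ 0) (hA : A.IsSymm)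
    {Q : Matrix (Fin n ⊕ Fin n) (Fin n ⊕ Fin n) ℂ} (hQ : Q ∈ nomura (matW A B))
    (hQ' : Q ∈ nomura (matW' A B)) : cellLift Q ∈ nomura (matV d A B) := by
  rintro (a | a) (b | b)
  · obtain ⟨c, hc⟩ := hQ a b
    refine ⟨c, ?_⟩
    rw [nomuraVec_matV_inl hd hA, cellLift_mulVec_comp, hc]
    rfl
  · exact ⟨0, by rw [cellLift_mulVec_of_isAlternating _
      (isAlternating_nomuraVec_matV_inl_inr d a b), zero_smul]⟩
  · exact ⟨0, by rw [cellLift_mulVec_of_isAlternating _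
      (isAlternating_nomuraVec_matV_inr_inl d a b), zero_smul]⟩
  · obtain ⟨c, hc⟩ := hQ' a b
    refine ⟨c, ?_⟩
    rw [nomuraVec_matV_inr hd, cellLift_mulVec_comp, hc]
    rfl

theorem BraidPair.isUnit_matW (h : BraidPair A B) : IsUnit (matW A B) := by
  rcases Nat.eq_zero_or_pos n with rfl | hn
  · exact isUnit_of_subsingleton _
  have hn' : (n : ℂ) ≠ 0 := by exact_mod_cast hn.ne'
  have h1 : A * schurInv A = (n : ℂ) • 1 := by
    have : (schurInv A)ᵀ = schurInv A := by
      ext i j; simp [schurInv, h.comm i j]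
    simpa [this] using h.isTypeII_left.mul_schurInv_transpose
  have h2 : (schurInv B)ᵀ * B = (n : ℂ) • 1 := by
    simpa [IsTypeII] using h.isTypeII_right
  have key : matW A B * ((2 * n : ℂ)⁻¹ • fromBlocks (schurInv A) B (-schurInv A) B) = 1 := by
    rw [matW, mul_smul_comm, fromBlocks_multiply, h.symm.eq]
    simp only [Matrix.neg_mul, Matrix.mul_neg, neg_neg, h1, h2, add_neg_cancel]
    rw [← two_smul ℂ, smul_smul, fromBlocks_smul, smul_smul, inv_mul_cancel₀ (mul_ne_zero two_ne_zero hn'),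
      smul_zero, one_smul, fromBlocks_one]
  exact IsUnit.of_mul_eq_one _ key

theorem BraidPair.matW_ne_zero (h : BraidPair A B) : SchurInvertible (matW A B) := by
  rintro (i | i) (j | j) <;> simp [matW, schurInv, h.left_ne _ _, h.right_ne _ _]

/-- Every element of the Nomura algebra of `V` has a quotient. -/
theorem BraidPair.exists_quotient (h : BraidPair A B) {d : ℂ} (hd : d ≠ 0)
    {M : Matrix ((Fin n ⊕ Fin n) ⊕ (Fin n ⊕ Fin n)) ((Fin n ⊕ Fin n) ⊕ (Fin n ⊕ Fin n)) ℂ}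
    (hM : M ∈ nomura (matV d A B)) (b : Fin n ⊕ Fin n) :
    ∃ Q : Matrix (Fin n ⊕ Fin n) (Fin n ⊕ Fin n) ℂ,
      M * charMatrix (pairCells n) = charMatrix (pairCells n) * Q := by
  choose c hc using fun a => hM (Sum.inl a) (Sum.inl b)
  -- For fixed `b` the vectors of `W` are its columns rescaled row by row, so they form a basis.
  obtain ⟨U, hU⟩ : ∃ U, U = (diagonal fun k => (matW A B k b)⁻¹) * matW A B := ⟨_, rfl⟩
  have hcol : ∀ a, U.col a = nomuraVec (matW A B) a b := by
    intro a
    ext k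
    simp [hU, diagonal_mul, nomuraVec, schurInv, mul_comm]
  have hUu : IsUnit U := by
    rw [hU]
    refine IsUnit.mul ?_ h.isUnit_matW
    rw [isUnit_diagonal, Pi.isUnit_iff]
    exact fun k => (inv_ne_zero (h.matW_ne_zero k b)).isUnit
  have hMU : M * charMatrix (pairCells n) * U =
      charMatrix (pairCells n) * (U * diagonal c) := by
    apply ext_of_mulVec_single
    intro a
    have hdc : (U * diagonal c) *ᵥ Pi.single a 1 = c a • U.col a := by
      ext k; simp [mul_comm]
    rw [← mulVec_mulVec, ← mulVec_mulVec, ← mulVec_mulVec _ (charMatrix _), hdc, mulVec_single_one,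
      hcol, mulVec_smul, charMatrix_mulVec, ← nomuraVec_matV_inl hd h.symm, hc]
  obtain ⟨u, hu⟩ := hUu
  refine ⟨U * diagonal c * (↑u⁻¹ : Matrix _ _ ℂ), ?_⟩
  rw [← Matrix.mul_assoc, ← hMU, ← hu, Matrix.mul_assoc (M * charMatrix (pairCells n)),
    Units.mul_inv, Matrix.mul_one]

theorem IsInvertibleJonesPair.quotient_nomura_matV {d : ℂ} (hd : d ^ 2 = (n : ℂ))
    (hAB : IsInvertibleJonesPair A B) (hA : A.IsSymm) :
    IsEquitable (nomura (matV d A B)) (pairCells n) ∧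
      quotient (nomura (matV d A B)) (pairCells n) =
        (nomura (matW A B) :
          Set (Matrix (Fin n ⊕ Fin n) (Fin n ⊕ Fin n) ℂ)) := by
  have h := hAB.braidPair hA
  have h' := hAB.braidPair_transpose hA
  -- When `n = 0`, `d` is zero, so nonvanishing is only claimed given an index.
  have hd0 : ∀ _ : Fin n, d ≠ 0 := by
    rintro i rfl
    have : (n : ℂ) = 0 := by rw [← hd]; simp
    exact (Fin.pos i).ne' (by exact_mod_cast this)
  have hcell : ∀ _ : Fin n ⊕ Fin n, d ≠ 0 := fun a => a.elim hd0 hd0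
  refine ⟨fun M hM => ?_, Set.ext fun Q => ⟨?_, fun hQ => ?_⟩⟩
  · rcases isEmpty_or_nonempty (Fin n ⊕ Fin n) with hn | ⟨⟨b⟩⟩
    · exact ⟨0, by ext x k; exact hn.elim k⟩
    · exact h.exists_quotient (hcell b) hM b
  · rintro ⟨M, hM, hMQ⟩ a b
    obtain ⟨c, hc⟩ := hM (Sum.inl a) (Sum.inl b)
    refine ⟨c, comp_cellOf_injective ?_⟩
    change (Q *ᵥ nomuraVec (matW A B) a b) ∘ cellOf = c • (nomuraVec (matW A B) a b ∘ cellOf)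
    rw [← nomuraVec_matV_inl (hcell a) hA, ← hc, nomuraVec_matV_inl (hcell a) hA,
      ← charMatrix_mulVec, ← charMatrix_mulVec, mulVec_mulVec, mulVec_mulVec, hMQ]
  · refine ⟨cellLift Q, ?_, cellLift_mul_charMatrix Q⟩
    rcases isEmpty_or_nonempty (Fin n ⊕ Fin n) with hn | ⟨⟨b⟩⟩
    · rintro (a | a) <;> exact hn.elim a
    · exact cellLift_mem_nomura (hcell b) hA hQ (nomura_matW_le h h' hQ)

end JonesPair

theorem mainTheorem5 (n : ℕ) (d : ℂ) (hd : d ^ 2 = (n : ℂ))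
    (A B : Matrix (Fin n) (Fin n) ℂ)
    (hAB : JonesPair.IsInvertibleJonesPair A B) (hA : A.IsSymm) :
    JonesPair.IsEquitable (JonesPair.nomura (JonesPair.matV d A B)) (JonesPair.pairCells n) ∧
      JonesPair.quotient (JonesPair.nomura (JonesPair.matV d A B)) (JonesPair.pairCells n) =
        (JonesPair.nomura (JonesPair.matW A B) :
          Set (Matrix (Fin n ⊕ Fin n) (Fin n ⊕ Fin n) ℂ)) := by
  exact hAB.quotient_nomura_matV hd hA
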